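/- Let $P_{XY}$ be a joint distribution on finite alphabets $\mathcal X\times\mathcal Y$ and let $\alpha\in(1,\infty)$. The maximal $\alpha$-leakage from $X$ to $Y$ is $$\mathcal L_\alpha^{\max}(X\to Y)=\sup_{U-X-Y}\ \lim_{\alpha'\to\alpha}\frac{\alpha'}{\alpha'-1}\log\frac{\max_{P_{\hat U|Y}}\mathbb E\big[\mathbb P(U=\hat U\mid U,Y)^{(\alpha'-1)/\alpha'}\big]}{\max_{P_{\hat U}}\mathbb E\big[\mathbb P(U=\hat U\mid U)^{(\alpha'-1)/\alpha'}\big]},$$ where the supremum is over all finite alphabets and all random variables $U$ on them, obtained from $X$ through a channel $P_{U|X}$, such that $U-X-Y$ is a Markov chain. In the numerator the guess $\hat U$ is drawn from $P_{\hat U|Y}$, so that $\mathbb P(U=\hat U\mid U=u,Y=y)=P_{\hat U|Y}(u|y)$; in the denominator it is drawn from $P_{\hat U}$, so that $\mathbb P(U=\hat U\mid U=u)=P_{\hat U}(u)$. For $f$ convex with $f(1)=0$ let $D_f(P\|Q)=\sum_z Q(z)\,f\big(P(z)/Q(z)\big)$, with the usual convention $0\cdot f(s/0)=s\lim_{t\to\infty}f(t)/t$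 (which is $0$ for $s=0$), and let $$\mathcal L_f^{\max}(X\to Y)=\sup_{P_{\tilde X}}\ \inf_{Q_Y}\ D_f\big(P_{\tilde X}P_{Y|X}\,\big\|\,P_{\tilde X}\times Q_Y\big),$$ where $P_{\tilde X}$ ranges over the distributions on $\mathcal X$ with the same support as $P_X$ and $Q_Y$ over all distributions on $\mathcal Y$. Let $f_\alpha(t)=\frac{t^\alpha-1}{\alpha-1}$, so that $D_{f_\alpha}$ is the Hellinger divergence of order $\alpha$. Then the limit in the definition of $\mathcal L_\alpha^{\max}$ exists for every such $U$, $\mathcal L_{f_\alpha}^{\max}(X\to Y)$ is finite and nonnegative, and $$\mathcal L_\alpha^{\max}(X\to Y)=\frac1{\alpha-1}\log\Big(1+(\alpha-1)\,\mathcal L_{f_\alpha}^{\max}(X\to Y)\Big).$$ -/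

import Mathlib

open Filter Topology
open scoped BigOperators

noncomputable section

namespace AlphaLeakage

universe u v w

/-- Probability distributions on a finite alphabet `A`, as real vectors. -/
abbrev Dist (A : Type u) [Fintype A] : Type u := stdSimplex ℝ A

/-- Channels (conditional distributions) from `A` to `B`. -/
abbrev Channel (A : Type u) (B : Type v) [Fintype B] : Type (max u v) := A → Dist B

section Joint

variable {X : Type u} {Y : Type v} [Fintype X] [Fintype Y]

/-- The marginal `P_X` of a joint distribution `P_{XY}`. -/
def margX (P : Dist (X × Y)) (x : X) : ℝ := ∑ y, P.1 (x, y)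

/-- The conditional probability `P_{Y|X}(y|x)`; equal to `0` at the letters `x` of probability
zero, where it never matters, since only input laws with the support of `P_X` are considered. -/
def condYX (P : Dist (X × Y)) (x : X) (y : Y) : ℝ := P.1 (x, y) / margX P x

/-- The law `P_{UY}` of `(U, Y)` when `U - X - Y` is the Markov chain determined by `P_{XY}`
and the channel `W = P_{U|X}`, i.e. `P_{UXY}(u,x,y) = P_{U|X}(u|x) P_{XY}(x,y)`. -/
def jointUY {U : Type w} [Fintype U] (P : Dist (X × Y)) (W : Channel X U) (i : U) (y : Y) : ℝ :=
  ∑ x, (W x).1 i * P.1 (x, y)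

/-- The law `P_U` of `U` in the Markov chain `U - X - Y` determined by `P_{XY}` and `W = P_{U|X}`. -/
def margU {U : Type w} [Fintype U] (P : Dist (X × Y)) (W : Channel X U) (i : U) : ℝ :=
  ∑ y, jointUY P W i y

/-- `max_{P_{Û|Y}} E[P(U = Û | U, Y)^((a-1)/a)]`: the largest expected gain of an adversary who
observes `Y` and guesses `U` by a random `Û` drawn from `P_{Û|Y}`. For `a > 1` the gain is continuous in `P_{Û|Y}` and at
most `1`, and the channels form a compact set, so the supremum is a maximum. -/
def gainWithY {U : Type w} [Fintype U] (P : Dist (X × Y)) (W : Channel X U) (a : ℝ) : ℝ :=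
  ⨆ V : Channel Y U, ∑ i, ∑ y, jointUY P W i y * (V y).1 i ^ ((a - 1) / a)

/-- `max_{P_Û} E[P(U = Û | U)^((a-1)/a)]`: the largest expected gain without observing `Y`. -/
def gainBlind {U : Type w} [Fintype U] (P : Dist (X × Y)) (W : Channel X U) (a : ℝ) : ℝ :=
  ⨆ V : Dist U, ∑ i, margU P W i * V.1 i ^ ((a - 1) / a)

/-- `a/(a-1) · log` of the ratio of the two maximal expected gains. -/
def logGain {U : Type w} [Fintype U] (P : Dist (X × Y)) (W : Channel X U) (a : ℝ) : ℝ :=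
  a / (a - 1) * Real.log (gainWithY P W a / gainBlind P W a)

/-- Maximal `α`-leakage from `X` to `Y`, for a finite order `α > 1`: the supremum over all Markov
chains `U - X - Y` with `U` in a finite alphabet, of the limit as `α' → α` of `logGain`.
Every finite alphabet is, up to relabelling, some `Fin n`. -/
def maxAlphaLeakage (P : Dist (X × Y)) (α : ℝ) : EReal :=
  ⨆ (n : ℕ) (W : Channel X (Fin n)), ((limUnder (𝓝[≠] α) (logGain P W) : ℝ) : EReal)

end Joint

/-- `lim_{t → ∞} f(t)/t` in the extended reals (the limit exists for convex `f`). -/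
def slopeAtTop (f : ℝ → ℝ) : EReal :=
  limsup (fun t : ℝ => ((f t / t : ℝ) : EReal)) atTop

/-- The `f`-divergence `D_f(p‖q) = ∑ q f(p/q)` on a finite alphabet, with the standard convention
`0 · f(s/0) = s · lim_{t → ∞} f(t)/t` (in particular `0 · f(0/0) = 0`). -/
def fDiv {A : Type u} [Fintype A] (f : ℝ → ℝ) (p q : A → ℝ) : EReal :=
  ∑ i, if q i = 0 then (p i : EReal) * slopeAtTop f else ((q i * f (p i / q i) : ℝ) : EReal)

/-- The distribution-independent `f`-leakage
`sup_{P_X̃} inf_{Q_Y} D_f(P_X̃ P_{Y|X} ‖ P_X̃ × Q_Y)`, where `P_X̃` ranges over the distributions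
with the same support as `P_X`. -/
def maxFLeakage {X : Type u} {Y : Type v} [Fintype X] [Fintype Y]
    (f : ℝ → ℝ) (P : Dist (X × Y)) : EReal :=
  ⨆ (R : Dist X) (_ : Function.support R.1 = Function.support (margX P)),
    ⨅ Q : Dist Y,
      fDiv f (fun z : X × Y => R.1 z.1 * condYX P z.1 z.2) (fun z : X × Y => R.1 z.1 * Q.1 z.2)

/-- The generator `f_α(t) = (t^α - 1)/(α - 1)` of the Hellinger divergence of order `α`. -/
def hellinger (α : ℝ) (t : ℝ) : ℝ := (t ^ α - 1) / (α - 1)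

end AlphaLeakage

end

/-! Both leakages are governed by the supremum, over the input laws `R` with the support of `P_X`,
of Gallager's sum `G(R) = ∑_y (∑_x R(x) P_{Y|X}(y|x)^α)^(1/α)`.

*`f_α`-leakage.* By Jensen, `D_{f_α}(R P_{Y|X} ‖ R × Q)` is at least `(G(R)^α - 1)/(α - 1)`, with
equality when `Q(y)` is proportional to the `y`-th term of `G(R)`.

*`α`-leakage.* By Hölder duality the two maximal gains are `∑_y ‖P_{UY}(·, y)‖_α` and `‖P_U‖_α`.
Their ratio is at most `G(R)`, where `R` is the law of `X` obtained by keeping `P_{X|U}` and tilting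
the law of `U` to be proportional to `P_U^α`. Conversely, splitting each letter `x` at random into
finitely many letters, in proportions whose `α`-th powers sum to `s(x)`, makes the ratio equal to
`G(R)` for `R` proportional to `s P_X^α`. By the intermediate value theorem `s(x)` can be any number
in `(0, 1]`, so every `R` with the support of `P_X` arises.
-/

noncomputable section

namespace AlphaLeakage

section Simplex

variable {ι : Type*} [Fintype ι]

theorem exists_dist_apply_pos (p : Dist ι) : ∃ i, 0 < p.1 i := by
  obtain ⟨i, -, hi⟩ : ∃ i ∈ Finset.univ, 0 < p.1 i :=
    Finset.exists_lt_of_sum_lt (by simp [p.2.2])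
  exact ⟨i, hi⟩

/-- The distribution proportional to a nonnegative weight `w` of positive total mass. -/
def normalized (w : ι → ℝ) (hw : ∀ i, 0 ≤ w i) (hpos : 0 < ∑ i, w i) : Dist ι :=
  ⟨fun i => w i / ∑ j, w j, fun i => div_nonneg (hw i) hpos.le, by
    rw [← Finset.sum_div, div_self hpos.ne']⟩

theorem exists_dist_sum_rpow_eq [Nonempty ι] {a s : ℝ} (ha : 0 < a)
    (hs : (Fintype.card ι : ℝ) ^ (1 - a) ≤ s) (hs1 : s ≤ 1) :
    ∃ p : Dist ι, ∑ i, p.1 i ^ a = s := by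
  classical
  have hcont : Continuous fun p : Dist ι => ∑ i, p.1 i ^ a := by
    refine continuous_finsetSum _ fun i _ => ?_
    exact ((continuous_apply i).comp continuous_subtype_val).rpow_const fun _ => Or.inr ha.le
  have hcard : (0 : ℝ) < Fintype.card ι := Nat.cast_pos.2 Fintype.card_pos
  let uniform : Dist ι := ⟨fun _ => (Fintype.card ι : ℝ)⁻¹, fun _ => by positivity, by simp⟩
  have huniform : ∑ i, uniform.1 i ^ a = (Fintype.card ι : ℝ) ^ (1 - a) := by
    simp only [uniform, Finset.sum_const, Finset.card_univ, nsmul_eq_mul]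
    rw [Real.inv_rpow hcard.le, Real.rpow_sub hcard, Real.rpow_one, div_eq_mul_inv]
  let vertex : Dist ι := ⟨Pi.single (Classical.arbitrary ι) 1, single_mem_stdSimplex ℝ _⟩
  have hvertex : ∑ i, vertex.1 i ^ a = 1 := by
    simp [vertex, Pi.single_apply, apply_ite (· ^ a), Real.zero_rpow ha.ne']
  exact mem_range_of_exists_le_of_exists_ge hcont ⟨uniform, huniform.trans_le hs⟩
    ⟨vertex, hs1.trans_eq hvertex.symm⟩

theorem rpow_sum_le_sum_mul_div_rpow {a : ℝ} (ha : 1 ≤ a) (q : Dist ι) {c : ι → ℝ}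
    (hc : ∀ i, 0 ≤ c i) (hac : ∀ i, q.1 i = 0 → c i = 0) :
    (∑ i, c i) ^ a ≤ ∑ i, q.1 i * (c i / q.1 i) ^ a := by
  have hmean : ∑ i, c i = ∑ i, q.1 i * (c i / q.1 i) :=
    Finset.sum_congr rfl fun i _ => (mul_div_cancel_of_imp' (hac i)).symm
  rw [hmean]
  exact Real.rpow_arith_mean_le_arith_mean_rpow _ _ _ (fun i _ => q.2.1 i) q.2.2
    (fun i _ => div_nonneg (hc i) (q.2.1 i)) ha

theorem sum_normalized_mul_div_rpow (a : ℝ) {c : ι → ℝ} (hc : ∀ i, 0 ≤ c i)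
    (hpos : 0 < ∑ i, c i) :
    ∑ i, (normalized c hc hpos).1 i * (c i / (normalized c hc hpos).1 i) ^ a =
      (∑ i, c i) ^ a := by
  have hterm : ∀ i, (normalized c hc hpos).1 i * (c i / (normalized c hc hpos).1 i) ^ a =
      (normalized c hc hpos).1 i * (∑ j, c j) ^ a := fun i => by
    rcases eq_or_ne (c i) 0 with hi | hi
    · simp [normalized, hi]
    · rw [normalized, div_div_cancel₀ hi]
  rw [Finset.sum_congr rfl fun i _ => hterm i, ← Finset.sum_mul, (normalized c hc hpos).2.2,
    one_mul]

end Simplex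

section PowNorm

variable {ι : Type*} [Fintype ι]

/-- The `ℓ^a` norm of a nonnegative vector `c`. No absolute values are taken. -/
def powNorm (a : ℝ) (c : ι → ℝ) : ℝ := (∑ i, c i ^ a) ^ (1 / a)

theorem sum_rpow_pos (a : ℝ) {c : ι → ℝ} (hc : ∀ i, 0 ≤ c i) (hpos : ∃ i, 0 < c i) :
    0 < ∑ i, c i ^ a := by
  obtain ⟨i, hi⟩ := hpos
  exact Finset.sum_pos' (fun j _ => Real.rpow_nonneg (hc j) a)
    ⟨i, Finset.mem_univ i, Real.rpow_pos_of_pos hi a⟩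

theorem powNorm_nonneg (a : ℝ) {c : ι → ℝ} (hc : ∀ i, 0 ≤ c i) : 0 ≤ powNorm a c :=
  Real.rpow_nonneg (Finset.sum_nonneg fun i _ => Real.rpow_nonneg (hc i) a) _

theorem powNorm_pos (a : ℝ) {c : ι → ℝ} (hc : ∀ i, 0 ≤ c i) (hpos : ∃ i, 0 < c i) :
    0 < powNorm a c :=
  Real.rpow_pos_of_pos (sum_rpow_pos a hc hpos) _

theorem continuousAt_powNorm {a : ℝ} (ha : 0 < a) (c : ι → ℝ) :
    ContinuousAt (fun b => powNorm b c) a := by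
  have hsum : ContinuousAt (fun b => ∑ i, c i ^ b) a :=
    tendsto_finsetSum _ fun _ _ => Real.continuousAt_const_rpow' ha.ne'
  exact hsum.rpow (continuousAt_const.div continuousAt_id ha.ne') (Or.inr (one_div_pos.2 ha))

theorem sum_mul_rpow_le_powNorm {a : ℝ} (ha : 1 < a) {c : ι → ℝ} (hc : ∀ i, 0 ≤ c i)
    (p : Dist ι) : ∑ i, c i * p.1 i ^ ((a - 1) / a) ≤ powNorm a c := by
  have hdual : ∀ i, (p.1 i ^ ((a - 1) / a)) ^ (a / (a - 1)) = p.1 i := fun i => by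
    rw [← inv_div, Real.rpow_inv_rpow (p.2.1 i) (div_pos (by linarith) (by linarith)).ne']
  refine (Real.inner_le_Lp_mul_Lq_of_nonneg Finset.univ (.conjExponent ha) (fun i _ => hc i)
    fun i _ => Real.rpow_nonneg (p.2.1 i) _).trans_eq ?_
  simp only [Real.conjExponent, hdual, p.2.2, Real.one_rpow, mul_one, powNorm]

theorem sum_mul_normalized_rpow_eq_powNorm {a : ℝ} (ha : 1 < a) {c : ι → ℝ} (hc : ∀ i, 0 ≤ c i)
    (hpos : 0 < ∑ i, c i ^ a) :
    ∑ i, c i * (normalized (fun i => c i ^ a) (fun i => Real.rpow_nonneg (hc i) a) hpos).1 i ^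
      ((a - 1) / a) = powNorm a c := by
  have ha0 : a ≠ 0 := by linarith
  have hterm : ∀ i, c i * (c i ^ a / ∑ j, c j ^ a) ^ ((a - 1) / a) =
      c i ^ a / (∑ j, c j ^ a) ^ ((a - 1) / a) := fun i => by
    rw [Real.div_rpow (Real.rpow_nonneg (hc i) a) hpos.le, ← Real.rpow_mul (hc i),
      mul_div_cancel₀ _ ha0, ← mul_div_assoc, ← Real.rpow_one_add' (hc i) (by simpa using ha0),
      add_sub_cancel]
  have hexp : 1 / a = 1 - (a - 1) / a := by field_simp; ring
  rw [normalized, Finset.sum_congr rfl fun i _ => hterm i, ← Finset.sum_div, powNorm, hexp,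
    Real.rpow_sub hpos, Real.rpow_one]

theorem isGreatest_powNorm [Nonempty ι] {a : ℝ} (ha : 1 < a) {c : ι → ℝ} (hc : ∀ i, 0 ≤ c i) :
    IsGreatest (Set.range fun p : Dist ι => ∑ i, c i * p.1 i ^ ((a - 1) / a)) (powNorm a c) := by
  refine ⟨?_, Set.forall_mem_range.2 (sum_mul_rpow_le_powNorm ha hc)⟩
  by_cases hpos : ∃ i, 0 < c i
  · exact ⟨_, sum_mul_normalized_rpow_eq_powNorm ha hc (sum_rpow_pos a hc hpos)⟩
  · have hzero : ∀ i, c i = 0 := fun i => (not_lt.1 fun hi => hpos ⟨i, hi⟩).antisymm (hc i)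
    have ha0 : a ≠ 0 := by linarith
    exact ⟨Classical.arbitrary _, by simp [powNorm, hzero, Real.zero_rpow, ha0]⟩

end PowNorm

section Laws

variable {X Y U : Type*} [Fintype X] [Fintype Y] [Fintype U] (P : Dist (X × Y))
  (W : Channel X U)

theorem margX_nonneg (x : X) : 0 ≤ margX P x :=
  Finset.sum_nonneg fun _ _ => P.2.1 _

theorem margX_mem_stdSimplex : margX P ∈ stdSimplex ℝ X :=
  ⟨margX_nonneg P, (Fintype.sum_prod_type _).symm.trans P.2.2⟩

theorem le_margX (x : X) (y : Y) : P.1 (x, y) ≤ margX P x :=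
  Finset.single_le_sum (f := fun y => P.1 (x, y)) (fun _ _ => P.2.1 _) (Finset.mem_univ y)

theorem condYX_nonneg (x : X) (y : Y) : 0 ≤ condYX P x y :=
  div_nonneg (P.2.1 _) (margX_nonneg P x)

theorem condYX_le_one (x : X) (y : Y) : condYX P x y ≤ 1 :=
  div_le_one_of_le₀ (le_margX P x y) (margX_nonneg P x)

theorem sum_condYX {x : X} (hx : margX P x ≠ 0) : ∑ y, condYX P x y = 1 := by
  simp only [condYX, ← Finset.sum_div]
  exact div_self hx

theorem margX_mul_condYX (x : X) (y : Y) : margX P x * condYX P x y = P.1 (x, y) :=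
  mul_div_cancel_of_imp' fun hx => (hx ▸ le_margX P x y).antisymm (P.2.1 _)

theorem jointUY_nonneg (i : U) (y : Y) : 0 ≤ jointUY P W i y :=
  Finset.sum_nonneg fun x _ => mul_nonneg ((W x).2.1 i) (P.2.1 _)

theorem jointUY_eq_sum_mul_condYX (i : U) (y : Y) :
    jointUY P W i y = ∑ x, (W x).1 i * margX P x * condYX P x y := by
  simp only [jointUY, mul_assoc, margX_mul_condYX]

theorem margU_nonneg (i : U) : 0 ≤ margU P W i :=
  Finset.sum_nonneg fun y _ => jointUY_nonneg P W i y

theorem margU_eq_sum_mul_margX (i : U) : margU P W i = ∑ x, (W x).1 i * margX P x := by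
  simp only [margU, jointUY, margX, Finset.mul_sum]
  exact Finset.sum_comm

theorem margU_mem_stdSimplex : margU P W ∈ stdSimplex ℝ U := by
  refine ⟨margU_nonneg P W, ?_⟩
  simp only [margU_eq_sum_mul_margX]
  rw [Finset.sum_comm]
  simp only [← Finset.sum_mul, (W _).2.2, one_mul, (margX_mem_stdSimplex P).2]

theorem exists_margU_pos : ∃ i, 0 < margU P W i :=
  exists_dist_apply_pos ⟨_, margU_mem_stdSimplex P W⟩

theorem exists_jointUY_pos : ∃ y i, 0 < jointUY P W i y := by
  obtain ⟨i, hi⟩ := exists_margU_pos P W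
  obtain ⟨y, -, hy⟩ := Finset.exists_ne_zero_of_sum_ne_zero hi.ne'
  exact ⟨y, i, (jointUY_nonneg P W i y).lt_of_ne' hy⟩

end Laws

section Gain

variable {X Y U : Type*} [Fintype X] [Fintype Y] [Fintype U] (P : Dist (X × Y))
  (W : Channel X U) {α : ℝ}

theorem gainBlind_eq_powNorm (hα : 1 < α) : gainBlind P W α = powNorm α (margU P W) :=
  have := (exists_margU_pos P W).nonempty
  (isGreatest_powNorm hα (margU_nonneg P W)).csSup_eq

theorem gainWithY_eq_sum_powNorm (hα : 1 < α) :
    gainWithY P W α = ∑ y, powNorm α fun i => jointUY P W i y := by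
  have := (exists_margU_pos P W).nonempty
  have hmax := fun y => isGreatest_powNorm hα fun i => jointUY_nonneg P W i y
  simp only [gainWithY, Finset.sum_comm (s := (Finset.univ : Finset U))]
  refine IsGreatest.csSup_eq ⟨?_, Set.forall_mem_range.2 fun V => ?_⟩
  · choose V hV using fun y => (hmax y).1
    exact ⟨V, Finset.sum_congr rfl fun y _ => hV y⟩
  · exact Finset.sum_le_sum fun y _ => (hmax y).2 ⟨V y, rfl⟩

theorem powNorm_margU_pos (a : ℝ) : 0 < powNorm a (margU P W) :=
  powNorm_pos a (margU_nonneg P W) (exists_margU_pos P W)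

theorem sum_powNorm_jointUY_pos (a : ℝ) : 0 < ∑ y, powNorm a fun i => jointUY P W i y := by
  obtain ⟨y, hy⟩ := exists_jointUY_pos P W
  exact Finset.sum_pos' (fun z _ => powNorm_nonneg a fun i => jointUY_nonneg P W i z)
    ⟨y, Finset.mem_univ y, powNorm_pos a (fun i => jointUY_nonneg P W i y) hy⟩

theorem logGain_eq_log_powNorm (hα : 1 < α) :
    logGain P W α = α / (α - 1) * Real.log
      ((∑ y, powNorm α fun i => jointUY P W i y) / powNorm α (margU P W)) := by
  rw [logGain, gainWithY_eq_sum_powNorm P W hα, gainBlind_eq_powNorm P W hα]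

theorem continuousAt_logGain (hα : 1 < α) : ContinuousAt (logGain P W) α := by
  have hα0 : 0 < α := by linarith
  have hformula : logGain P W =ᶠ[𝓝 α] fun a => a / (a - 1) * Real.log
      ((∑ y, powNorm a fun i => jointUY P W i y) / powNorm a (margU P W)) := by
    filter_upwards [lt_mem_nhds hα] with a ha using logGain_eq_log_powNorm P W ha
  refine ContinuousAt.congr ?_ hformula.symm
  have hnum : ContinuousAt (fun a => ∑ y, powNorm a fun i => jointUY P W i y) α :=
    tendsto_finsetSum _ fun y _ => continuousAt_powNorm hα0 _
  have hden := powNorm_margU_pos P W α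
  exact (continuousAt_id.div (continuousAt_id.sub continuousAt_const) (sub_pos.2 hα).ne').mul
    ((hnum.div (continuousAt_powNorm hα0 _) hden.ne').log
      (div_pos (sum_powNorm_jointUY_pos P W α) hden).ne')

theorem tendsto_logGain (hα : 1 < α) : Tendsto (logGain P W) (𝓝[≠] α) (𝓝 (logGain P W α)) :=
  (continuousAt_logGain P W hα).continuousWithinAt

theorem maxAlphaLeakage_eq_iSup_logGain (hα : 1 < α) :
    maxAlphaLeakage P α = ⨆ (n : ℕ) (W : Channel X (Fin n)), (logGain P W α : EReal) := by
  refine iSup_congr fun n => iSup_congr fun W => ?_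
  rw [(tendsto_logGain P W hα).limUnder_eq]

theorem logGain_relabel {V : Type*} [Fintype V] (e : V ≃ U) (hα : 1 < α) :
    logGain P (fun x => (⟨fun j => (W x).1 (e j), fun j => (W x).2.1 (e j),
      (e.sum_comp _).trans (W x).2.2⟩ : Dist V)) α = logGain P W α := by
  rw [logGain_eq_log_powNorm P _ hα, logGain_eq_log_powNorm P W hα]
  simp only [powNorm, margU, jointUY]
  congr 4
  · exact funext fun y => congrArg (· ^ (1 / α)) (e.sum_comp fun i => jointUY P W i y ^ α)
  · exact e.sum_comp fun i => margU P W i ^ α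

theorem logGain_le_maxAlphaLeakage (hα : 1 < α) :
    (logGain P W α : EReal) ≤ maxAlphaLeakage P α := by
  rw [maxAlphaLeakage_eq_iSup_logGain P hα, ← logGain_relabel P W (Fintype.equivFin U).symm hα]
  exact le_iSup₂ (f := fun (n : ℕ) (W : Channel X (Fin n)) => (logGain P W α : EReal)) _ _

end Gain

section Gallager

variable {X Y : Type*} [Fintype X] {α : ℝ} {K : X → Y → ℝ} {r : X → ℝ}

/-- The term `(∑_x r(x) K(x, y)^α)^(1/α)` of Gallager's sum belonging to the output letter `y`, for
an input weight `r` and a kernel `K`. Neither needs to be normalized. -/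
def gallagerTerm (α : ℝ) (K : X → Y → ℝ) (r : X → ℝ) (y : Y) : ℝ :=
  (∑ x, r x * K x y ^ α) ^ (1 / α)

theorem sum_mul_rpow_nonneg (hK : ∀ x y, 0 ≤ K x y) (hr : ∀ x, 0 ≤ r x) (y : Y) :
    0 ≤ ∑ x, r x * K x y ^ α :=
  Finset.sum_nonneg fun x _ => mul_nonneg (hr x) (Real.rpow_nonneg (hK x y) α)

theorem gallagerTerm_nonneg (hK : ∀ x y, 0 ≤ K x y) (hr : ∀ x, 0 ≤ r x) (y : Y) :
    0 ≤ gallagerTerm α K r y :=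
  Real.rpow_nonneg (sum_mul_rpow_nonneg hK hr y) _

theorem gallagerTerm_rpow (hα : α ≠ 0) (hK : ∀ x y, 0 ≤ K x y) (hr : ∀ x, 0 ≤ r x) (y : Y) :
    gallagerTerm α K r y ^ α = ∑ x, r x * K x y ^ α := by
  rw [gallagerTerm, one_div, Real.rpow_inv_rpow (sum_mul_rpow_nonneg hK hr y) hα]

theorem gallagerTerm_eq_zero_iff (hα : α ≠ 0) (hK : ∀ x y, 0 ≤ K x y) (hr : ∀ x, 0 ≤ r x)
    (y : Y) : gallagerTerm α K r y = 0 ↔ ∀ x, r x = 0 ∨ K x y = 0 := by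
  rw [← Real.rpow_eq_zero (gallagerTerm_nonneg hK hr y) hα, gallagerTerm_rpow hα hK hr,
    Finset.sum_eq_zero_iff_of_nonneg fun x _ => mul_nonneg (hr x) (Real.rpow_nonneg (hK x y) α)]
  simp only [Finset.mem_univ, true_imp_iff, mul_eq_zero, Real.rpow_eq_zero (hK _ y) hα]

theorem sum_mul_le_gallagerTerm (hα : 1 ≤ α) (hK : ∀ x y, 0 ≤ K x y) (R : Dist X) (y : Y) :
    ∑ x, R.1 x * K x y ≤ gallagerTerm α K R.1 y := by
  have hmean : 0 ≤ ∑ x, R.1 x * K x y :=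
    Finset.sum_nonneg fun x _ => mul_nonneg (R.2.1 x) (hK x y)
  rw [gallagerTerm, one_div,
    Real.le_rpow_inv_iff_of_pos hmean (sum_mul_rpow_nonneg hK R.2.1 y) (by linarith)]
  exact Real.rpow_arith_mean_le_arith_mean_rpow _ _ _ (fun x _ => R.2.1 x) R.2.2
    (fun x _ => hK x y) hα

variable [Fintype Y]

/-- Gallager's sum `∑_y (∑_x r(x) K(x, y)^α)^(1/α)`. For a law `r` and a channel `K`, the Sibson
mutual information of order `α` is `α/(α-1)` times its logarithm. -/
def gallagerSum (α : ℝ) (K : X → Y → ℝ) (r : X → ℝ) : ℝ := ∑ y, gallagerTerm α K r y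

theorem gallagerSum_div (hK : ∀ x y, 0 ≤ K x y) (hr : ∀ x, 0 ≤ r x) {c : ℝ} (hc : 0 ≤ c) :
    gallagerSum α K (fun x => r x / c) = gallagerSum α K r / c ^ (1 / α) := by
  simp only [gallagerSum, gallagerTerm, Finset.sum_div, div_mul_eq_mul_div]
  simp only [← Finset.sum_div, Real.div_rpow (sum_mul_rpow_nonneg hK hr _) hc]

theorem one_le_gallagerSum (hα : 1 ≤ α) (hK : ∀ x y, 0 ≤ K x y) {R : Dist X}
    (hsum : ∀ x, R.1 x ≠ 0 → ∑ y, K x y = 1) : 1 ≤ gallagerSum α K R.1 := by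
  have hmass : ∀ x, R.1 x * ∑ y, K x y = R.1 x := fun x => by
    rcases eq_or_ne (R.1 x) 0 with hx | hx
    · rw [hx, zero_mul]
    · rw [hsum x hx, mul_one]
  calc (1 : ℝ) = ∑ x, R.1 x * ∑ y, K x y := by simp only [hmass, R.2.2]
    _ = ∑ y, ∑ x, R.1 x * K x y := by simp only [Finset.mul_sum]; exact Finset.sum_comm
    _ ≤ gallagerSum α K R.1 := Finset.sum_le_sum fun y _ => sum_mul_le_gallagerTerm hα hK R y

theorem gallagerSum_le_card (hα : 0 ≤ α) (hK : ∀ x y, 0 ≤ K x y) (hK1 : ∀ x y, K x y ≤ 1)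
    (R : Dist X) : gallagerSum α K R.1 ≤ Fintype.card Y := by
  have hterm : ∀ y, gallagerTerm α K R.1 y ≤ 1 := fun y => by
    refine Real.rpow_le_one (sum_mul_rpow_nonneg hK R.2.1 y) ?_ (one_div_nonneg.2 hα)
    rw [← R.2.2]
    exact Finset.sum_le_sum fun x _ =>
      mul_le_of_le_one_right (R.2.1 x) (Real.rpow_le_one (hK x y) (hK1 x y) hα)
  simpa [gallagerSum] using Finset.sum_le_sum fun y (_ : y ∈ Finset.univ) => hterm y

end Gallager

section FDiv

variable {A X Y : Type*} [Fintype A] [Fintype X] [Fintype Y] {α : ℝ}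

theorem ereal_coe_sum (f : A → ℝ) : ((∑ i, f i : ℝ) : EReal) = ∑ i, (f i : EReal) :=
  map_sum (⟨⟨Real.toEReal, EReal.coe_zero⟩, EReal.coe_add⟩ : ℝ →+ EReal) f Finset.univ

theorem ereal_sum_eq_top {f : A → EReal} (hf : ∀ i, f i ≠ ⊥) {i : A} (hi : f i = ⊤) :
    ∑ j, f j = ⊤ := by
  classical
  rw [← Finset.add_sum_erase _ f (Finset.mem_univ i), hi]
  exact EReal.top_add_of_ne_bot (Finset.sum_induction f (· ≠ ⊥)
    (fun _ _ ha hb => EReal.add_ne_bot_iff.2 ⟨ha, hb⟩) EReal.zero_ne_bot fun j _ => hf j)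

theorem fDiv_eq_sum (f : ℝ → ℝ) {p q : A → ℝ} (hac : ∀ i, q i = 0 → p i = 0) :
    fDiv f p q = ((∑ i, q i * f (p i / q i) : ℝ) : EReal) := by
  rw [ereal_coe_sum]
  refine Finset.sum_congr rfl fun i _ => ?_
  split_ifs with hi
  · simp [hi, hac i hi]
  · rfl

theorem fDiv_eq_top {f : ℝ → ℝ} (hf : slopeAtTop f = ⊤) {p q : A → ℝ} (hp : ∀ i, 0 ≤ p i)
    {i : A} (hq : q i = 0) (hpi : p i ≠ 0) : fDiv f p q = ⊤ := by
  refine ereal_sum_eq_top (i := i) (fun j => ?_) ?_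
  · split_ifs
    · rw [hf]
      exact (EReal.mul_nonneg (EReal.coe_nonneg.2 (hp j)) le_top).trans_lt' EReal.bot_lt_zero |>.ne'
    · exact EReal.coe_ne_bot _
  · rw [if_pos hq, hf, EReal.coe_mul_top_of_pos ((hp i).lt_of_ne' hpi)]

theorem slopeAtTop_hellinger (hα : 1 < α) : slopeAtTop (hellinger α) = ⊤ := by
  have hα1 : 0 < α - 1 := sub_pos.2 hα
  have hdiverge : Tendsto (fun t : ℝ => (t ^ (α - 1) + -t⁻¹) / (α - 1)) atTop atTop :=
    (tendsto_atTop_add_right_of_le' atTop (-1) (tendsto_rpow_atTop hα1) (by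
      filter_upwards [eventually_ge_atTop 1] with t ht
      exact neg_le_neg (inv_le_one_of_one_le₀ ht))).atTop_div_const hα1
  refine Tendsto.limsup_eq (EReal.tendsto_coe_nhds_top_iff.2 (hdiverge.congr' ?_))
  filter_upwards [eventually_gt_atTop 0] with t ht
  rw [hellinger, Real.rpow_sub_one ht.ne']
  field_simp
  ring

theorem sum_mul_hellinger (α : ℝ) (p q : A → ℝ) :
    ∑ i, q i * hellinger α (p i / q i) =
      (∑ i, q i * (p i / q i) ^ α - ∑ i, q i) / (α - 1) := by
  rw [← Finset.sum_sub_distrib, Finset.sum_div]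
  exact Finset.sum_congr rfl fun i _ => by rw [hellinger]; ring

variable {K : X → Y → ℝ} {R : Dist X}

theorem fDiv_hellinger_joint (hα : α ≠ 0) (hK : ∀ x y, 0 ≤ K x y) (Q : Dist Y)
    (hac : ∀ y, Q.1 y = 0 → gallagerTerm α K R.1 y = 0) :
    fDiv (hellinger α) (fun z : X × Y => R.1 z.1 * K z.1 z.2)
      (fun z : X × Y => R.1 z.1 * Q.1 z.2) =
      (((∑ y, Q.1 y * (gallagerTerm α K R.1 y / Q.1 y) ^ α - 1) / (α - 1) : ℝ) : EReal) := by
  have hmass : ∑ z : X × Y, R.1 z.1 * Q.1 z.2 = 1 := by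
    simp only [Fintype.sum_prod_type, ← Finset.mul_sum, Q.2.2, mul_one, R.2.2]
  have hpower : ∀ x y, R.1 x * Q.1 y * (R.1 x * K x y / (R.1 x * Q.1 y)) ^ α =
      Q.1 y * (R.1 x * K x y ^ α / Q.1 y ^ α) := fun x y => by
    rcases eq_or_ne (R.1 x) 0 with hx | hx
    · simp [hx]
    · rw [mul_div_mul_left _ _ hx, Real.div_rpow (hK x y) (Q.2.1 y)]
      ring
  rw [fDiv_eq_sum, sum_mul_hellinger, hmass, Fintype.sum_prod_type_right]
  · simp only [hpower, ← Finset.mul_sum, ← Finset.sum_div, ← gallagerTerm_rpow hα hK R.2.1,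
      ← Real.div_rpow (gallagerTerm_nonneg hK R.2.1 _) (Q.2.1 _)]
  · rintro ⟨x, y⟩ hxy
    rcases mul_eq_zero.1 hxy with hx | hy
    · exact mul_eq_zero_of_left hx _
    · exact mul_eq_zero.2 ((gallagerTerm_eq_zero_iff hα hK R.2.1 y).1 (hac y hy) x)

theorem gallagerSum_le_fDiv_hellinger (hα : 1 < α) (hK : ∀ x y, 0 ≤ K x y) (Q : Dist Y) :
    (((gallagerSum α K R.1 ^ α - 1) / (α - 1) : ℝ) : EReal) ≤
      fDiv (hellinger α) (fun z : X × Y => R.1 z.1 * K z.1 z.2)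
        (fun z : X × Y => R.1 z.1 * Q.1 z.2) := by
  have hα0 : α ≠ 0 := by linarith
  by_cases hac : ∀ y, Q.1 y = 0 → gallagerTerm α K R.1 y = 0
  · rw [fDiv_hellinger_joint hα0 hK Q hac, EReal.coe_le_coe_iff]
    exact div_le_div_of_nonneg_right (sub_le_sub_right (rpow_sum_le_sum_mul_div_rpow hα.le Q
      (gallagerTerm_nonneg hK R.2.1) hac) 1) (sub_nonneg.2 hα.le)
  · push Not at hac
    obtain ⟨y, hQ, hterm⟩ := hac
    obtain ⟨x, hx⟩ := not_forall.1 (mt (gallagerTerm_eq_zero_iff hα0 hK R.2.1 y).2 hterm)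
    refine le_top.trans_eq (fDiv_eq_top (slopeAtTop_hellinger hα) (i := (x, y))
      (fun z => mul_nonneg (R.2.1 _) (hK _ _)) ?_ ?_).symm
    · exact mul_eq_zero_of_right _ hQ
    · exact mt mul_eq_zero.1 hx

theorem iInf_fDiv_hellinger (hα : 1 < α) (hK : ∀ x y, 0 ≤ K x y)
    (hpos : 0 < gallagerSum α K R.1) :
    ⨅ Q : Dist Y, fDiv (hellinger α) (fun z : X × Y => R.1 z.1 * K z.1 z.2)
        (fun z : X × Y => R.1 z.1 * Q.1 z.2) =
      (((gallagerSum α K R.1 ^ α - 1) / (α - 1) : ℝ) : EReal) := by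
  refine le_antisymm ?_ (le_iInf fun Q => gallagerSum_le_fDiv_hellinger hα hK Q)
  have hterm := gallagerTerm_nonneg (α := α) hK R.2.1
  refine iInf_le_of_le (normalized (gallagerTerm α K R.1) hterm hpos) ?_
  rw [fDiv_hellinger_joint (by linarith) hK, sum_normalized_mul_div_rpow α hterm hpos]
  · rfl
  · exact fun y hy => (div_eq_zero_iff.1 hy).resolve_right hpos.ne'

end FDiv

section Tilting

variable {X Y U : Type*} [Fintype X] [Fintype Y] [Fintype U] (P : Dist (X × Y))
  (W : Channel X U) {α : ℝ}

/-- The law of `X`, up to normalization, when `P_{X|U}` is kept and `P_U` is replaced by `P_U^α`. -/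
def tiltedWeight (α : ℝ) (x : X) : ℝ := margX P x * ∑ i, (W x).1 i * margU P W i ^ (α - 1)

theorem tiltedWeight_nonneg (x : X) : 0 ≤ tiltedWeight P W α x :=
  mul_nonneg (margX_nonneg P x) (Finset.sum_nonneg fun i _ =>
    mul_nonneg ((W x).2.1 i) (Real.rpow_nonneg (margU_nonneg P W i) _))

theorem sum_tiltedWeight (hα : α ≠ 0) : ∑ x, tiltedWeight P W α x = ∑ i, margU P W i ^ α := by
  have hterm : ∀ i, margU P W i ^ α =
      ∑ x, (W x).1 i * margX P x * margU P W i ^ (α - 1) := fun i => by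
    rw [← Finset.sum_mul, ← margU_eq_sum_mul_margX,
      ← Real.rpow_one_add' (margU_nonneg P W i) (by simpa using hα), add_sub_cancel]
  simp only [tiltedWeight, hterm, Finset.mul_sum]
  rw [Finset.sum_comm]
  exact Finset.sum_congr rfl fun i _ => Finset.sum_congr rfl fun x _ => by ring

theorem support_tiltedWeight :
    Function.support (tiltedWeight P W α) = Function.support (margX P) := by
  refine Set.Subset.antisymm (fun x hx => left_ne_zero_of_mul hx) fun x hx => ?_
  have hxpos : 0 < margX P x := (margX_nonneg P x).lt_of_ne' hx
  obtain ⟨i, hi⟩ := exists_dist_apply_pos (W x)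
  have hU : 0 < margU P W i := by
    rw [margU_eq_sum_mul_margX]
    exact Finset.sum_pos' (fun x _ => mul_nonneg ((W x).2.1 i) (margX_nonneg P x))
      ⟨x, Finset.mem_univ x, mul_pos hi hxpos⟩
  refine (mul_pos hxpos (Finset.sum_pos' (fun j _ => ?_) ⟨i, Finset.mem_univ i, ?_⟩)).ne'
  · exact mul_nonneg ((W x).2.1 j) (Real.rpow_nonneg (margU_nonneg P W j) _)
  · exact mul_pos hi (Real.rpow_pos_of_pos hU _)

theorem jointUY_rpow_le (hα : 1 ≤ α) (i : U) (y : Y) :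
    jointUY P W i y ^ α ≤
      margU P W i ^ (α - 1) * ∑ x, (W x).1 i * margX P x * condYX P x y ^ α := by
  have hα0 : α ≠ 0 := by linarith
  have hw : ∀ x, 0 ≤ (W x).1 i * margX P x := fun x => mul_nonneg ((W x).2.1 i) (margX_nonneg P x)
  have hexp : (1 - α⁻¹) * α = α - 1 := by field_simp
  have hsum : 0 ≤ ∑ x, (W x).1 i * margX P x * condYX P x y ^ α :=
    sum_mul_rpow_nonneg (condYX_nonneg P) hw y
  have hholder := Real.inner_le_weight_mul_Lp_of_nonneg Finset.univ hα
    (fun x => (W x).1 i * margX P x) (fun x => condYX P x y) hw fun x => condYX_nonneg P x y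
  rw [← jointUY_eq_sum_mul_condYX, ← margU_eq_sum_mul_margX] at hholder
  refine (Real.rpow_le_rpow (jointUY_nonneg P W i y) hholder (by linarith)).trans_eq ?_
  rw [Real.mul_rpow (Real.rpow_nonneg (margU_nonneg P W i) _) (Real.rpow_nonneg hsum _),
    ← Real.rpow_mul (margU_nonneg P W i), hexp, Real.rpow_inv_rpow hsum hα0]

theorem powNorm_jointUY_le_gallagerTerm (hα : 1 ≤ α) (y : Y) :
    (powNorm α fun i => jointUY P W i y) ≤
      gallagerTerm α (condYX P) (tiltedWeight P W α) y := by
  refine Real.rpow_le_rpow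
    (Finset.sum_nonneg fun i _ => Real.rpow_nonneg (jointUY_nonneg P W i y) α) ?_
    (one_div_nonneg.2 (by linarith))
  refine (Finset.sum_le_sum fun i _ => jointUY_rpow_le P W hα i y).trans_eq ?_
  simp only [tiltedWeight, Finset.mul_sum, Finset.sum_mul]
  rw [Finset.sum_comm]
  exact Finset.sum_congr rfl fun x _ => Finset.sum_congr rfl fun i _ => by ring

end Tilting

section Splitting

variable {X : Type*} {α : ℝ}

theorem exists_card_rpow_le [Finite X] (hα : 1 < α) {s : X → ℝ} (hs : ∀ x, 0 < s x) :
    ∃ k : ℕ, 0 < k ∧ ∀ x, (k : ℝ) ^ (1 - α) ≤ s x := by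
  have hlim : Tendsto (fun k : ℕ => (k : ℝ) ^ (1 - α)) atTop (𝓝 0) := by
    simpa [Function.comp_def] using
      (tendsto_rpow_neg_atTop (sub_pos.2 hα)).comp tendsto_natCast_atTop_atTop
  exact ((eventually_gt_atTop 0).and
    (eventually_all.2 fun x => hlim.eventually_le_const (hs x))).exists

theorem exists_channel_sum_rpow_eq [Fintype X] (hα : 1 < α) {s : X → ℝ} (hs : ∀ x, 0 < s x)
    (hs1 : ∀ x, s x ≤ 1) :
    ∃ (k : ℕ) (W : Channel X (X × Fin k)), ∀ q : X → ℝ, (∀ x, 0 ≤ q x) →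
      ∑ u, (∑ x, (W x).1 u * q x) ^ α = ∑ x, s x * q x ^ α := by
  classical
  obtain ⟨k, hk, hks⟩ := exists_card_rpow_le hα hs
  have : NeZero k := ⟨hk.ne'⟩
  choose V hV using fun x => exists_dist_sum_rpow_eq (ι := Fin k) (zero_lt_one.trans hα)
    (by simpa using hks x) (hs1 x)
  let W : Channel X (X × Fin k) := fun x =>
    ⟨fun u => if u.1 = x then (V x).1 u.2 else 0,
      fun u => by dsimp only; split_ifs; exacts [(V x).2.1 _, le_rfl],
      by simp [Fintype.sum_prod_type, (V x).2.2]⟩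
  refine ⟨k, W, fun q hq => ?_⟩
  have hpiece : ∀ x j, ∑ x', (W x').1 (x, j) * q x' = (V x).1 j * q x := fun x j => by simp [W]
  simp only [Fintype.sum_prod_type, hpiece, Real.mul_rpow ((V _).2.1 _) (hq _), ← Finset.sum_mul,
    hV]

theorem exists_splitting_weight [Finite X] [Nonempty X] (hα : α ≠ 0) {p r : X → ℝ}
    (hp : ∀ x, 0 ≤ p x) (hr : ∀ x, 0 ≤ r x) (hsupp : Function.support r = Function.support p) :
    ∃ (s : X → ℝ) (c : ℝ), (∀ x, 0 < s x) ∧ (∀ x, s x ≤ 1) ∧ 0 < c ∧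
      ∀ x, r x = s x * p x ^ α / c := by
  have hzero : ∀ x, r x = 0 ↔ p x = 0 := fun x => not_iff_not.1 (Set.ext_iff.1 hsupp x)
  obtain ⟨t, ht, hrt⟩ : ∃ t : X → ℝ, (∀ x, 0 < t x) ∧ ∀ x, r x = t x * p x ^ α := by
    have hpoint : ∀ x, ∃ t : ℝ, 0 < t ∧ r x = t * p x ^ α := fun x => by
      rcases eq_or_ne (p x) 0 with hx | hx
      · exact ⟨1, one_pos, by rw [(hzero x).2 hx, hx, Real.zero_rpow hα, mul_zero]⟩
      · have hpx := Real.rpow_pos_of_pos ((hp x).lt_of_ne' hx) α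
        exact ⟨r x / p x ^ α, div_pos ((hr x).lt_of_ne' (mt (hzero x).1 hx)) hpx,
          (div_mul_cancel₀ _ hpx.ne').symm⟩
    choose t ht using hpoint
    exact ⟨t, fun x => (ht x).1, fun x => (ht x).2⟩
  obtain ⟨z, hz⟩ := Finite.exists_max t
  refine ⟨fun x => t x / t z, (t z)⁻¹, fun x => div_pos (ht x) (ht z),
    fun x => div_le_one_of_le₀ (hz x) (ht z).le, inv_pos.2 (ht z), fun x => ?_⟩
  have htz := (ht z).ne'
  rw [hrt x]
  field_simp

end Splitting

section Leakage

variable {X Y U : Type*} [Fintype X] [Fintype Y] [Fintype U] (P : Dist (X × Y)) {α : ℝ}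

/-- The laws `P_X̃` on the input alphabet that have the same support as `P_X`. -/
abbrev InputLaw : Type _ := {R : Dist X // Function.support R.1 = Function.support (margX P)}

/-- The supremum of Gallager's sum of the channel `P_{Y|X}` over the input laws with the support of
`P_X`, which governs both leakages. The family is bounded and nonempty, so the supremum of reals is
a genuine one. -/
def maxGallagerSum (α : ℝ) : ℝ := ⨆ R : InputLaw P, gallagerSum α (condYX P) R.1.1

instance : Nonempty (InputLaw P) := ⟨⟨⟨_, margX_mem_stdSimplex P⟩, rfl⟩⟩

theorem one_le_gallagerSum_condYX (hα : 1 ≤ α) (R : InputLaw P) :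
    1 ≤ gallagerSum α (condYX P) R.1.1 :=
  one_le_gallagerSum hα (condYX_nonneg P) fun _ hx => sum_condYX P (R.2.subset hx)

theorem bddAbove_gallagerSum (hα : 0 ≤ α) :
    BddAbove (Set.range fun R : InputLaw P => gallagerSum α (condYX P) R.1.1) :=
  ⟨_, Set.forall_mem_range.2 fun R =>
    gallagerSum_le_card hα (condYX_nonneg P) (condYX_le_one P) R.1⟩

theorem one_le_maxGallagerSum (hα : 1 ≤ α) : 1 ≤ maxGallagerSum P α :=
  let R : InputLaw P := Classical.arbitrary _
  (one_le_gallagerSum_condYX P hα R).trans (le_ciSup (bddAbove_gallagerSum P (by linarith)) R)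

theorem iSup_coe_comp_gallagerSum (hα : 1 ≤ α) {φ : ℝ → ℝ} (hmono : MonotoneOn φ (Set.Ioi 0))
    (hcont : ContinuousOn φ (Set.Ioi 0)) :
    ⨆ R : InputLaw P, (φ (gallagerSum α (condYX P) R.1.1) : EReal) =
      φ (maxGallagerSum P α) := by
  have hpos : Set.range (fun R : InputLaw P => gallagerSum α (condYX P) R.1.1) ⊆ Set.Ioi 0 :=
    Set.range_subset_iff.2 fun R => zero_lt_one.trans_le (one_le_gallagerSum_condYX P hα R)
  have hsup : maxGallagerSum P α ∈ Set.Ioi 0 := zero_lt_one.trans_le (one_le_maxGallagerSum P hα)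
  have hcoe : ContinuousWithinAt (fun t => (φ t : EReal)) (Set.Ioi 0) (maxGallagerSum P α) :=
    continuous_coe_real_ereal.continuousAt.comp_continuousWithinAt (hcont _ hsup)
  have hmap := MonotoneOn.map_csSup_of_continuousWithinAt (hcoe.mono hpos)
    (fun a ha b hb hab => EReal.coe_le_coe_iff.2 (hmono (hpos ha) (hpos hb) hab))
    (Set.range_nonempty _) (bddAbove_gallagerSum P (by linarith))
  rw [← Set.range_comp] at hmap
  exact hmap.symm

theorem maxFLeakage_hellinger_eq (hα : 1 < α) :
    maxFLeakage (hellinger α) P = (((maxGallagerSum P α ^ α - 1) / (α - 1) : ℝ) : EReal) := by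
  have hα0 : 0 ≤ α := by linarith
  have hmono : MonotoneOn (fun t : ℝ => (t ^ α - 1) / (α - 1)) (Set.Ioi 0) := fun a ha b _ hab =>
    div_le_div_of_nonneg_right (sub_le_sub_right (Real.rpow_le_rpow (le_of_lt ha) hab hα0) 1)
      (sub_nonneg.2 hα.le)
  have hcont : Continuous fun t : ℝ => (t ^ α - 1) / (α - 1) :=
    ((Real.continuous_rpow_const hα0).sub continuous_const).div_const _
  rw [maxFLeakage, iSup_subtype', ← iSup_coe_comp_gallagerSum P hα.le hmono hcont.continuousOn]
  exact iSup_congr fun R => iInf_fDiv_hellinger hα (condYX_nonneg P)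
    (zero_lt_one.trans_le (one_le_gallagerSum_condYX P hα.le R))

theorem exists_logGain_le (W : Channel X U) (hα : 1 < α) :
    ∃ R : InputLaw P, logGain P W α ≤ α / (α - 1) * Real.log (gallagerSum α (condYX P) R.1.1) := by
  have hα0 : 0 < α := by linarith
  have hmass := sum_tiltedWeight P W hα0.ne'
  have hpos : 0 < ∑ x, tiltedWeight P W α x :=
    hmass ▸ sum_rpow_pos α (margU_nonneg P W) (exists_margU_pos P W)
  let R : Dist X := normalized _ (tiltedWeight_nonneg P W) hpos
  have hsupp : Function.support R.1 = Function.support (margX P) := by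
    rw [← support_tiltedWeight P W (α := α)]
    ext x
    simp [R, normalized, hpos.ne']
  have hratio : (∑ y, powNorm α fun i => jointUY P W i y) / powNorm α (margU P W) ≤
      gallagerSum α (condYX P) R.1 := by
    simp only [R, normalized]
    rw [gallagerSum_div (condYX_nonneg P) (tiltedWeight_nonneg P W) hpos.le, hmass, ← powNorm]
    exact div_le_div_of_nonneg_right
      (Finset.sum_le_sum fun y _ => powNorm_jointUY_le_gallagerTerm P W hα.le y)
      (powNorm_margU_pos P W α).le
  refine ⟨⟨R, hsupp⟩, ?_⟩
  rw [logGain_eq_log_powNorm P W hα]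
  exact mul_le_mul_of_nonneg_left (Real.log_le_log
    (div_pos (sum_powNorm_jointUY_pos P W α) (powNorm_margU_pos P W α)) hratio)
    (div_nonneg hα0.le (sub_nonneg.2 hα.le))

theorem exists_logGain_eq (hα : 1 < α) (R : InputLaw P) :
    ∃ (k : ℕ) (W : Channel X (X × Fin k)),
      logGain P W α = α / (α - 1) * Real.log (gallagerSum α (condYX P) R.1.1) := by
  have := (exists_dist_apply_pos R.1).nonempty
  obtain ⟨s, c, hs, hs1, hc, hR⟩ := exists_splitting_weight (by linarith : α ≠ 0)
    (margX_nonneg P) R.1.2.1 R.2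
  obtain ⟨k, W, hW⟩ := exists_channel_sum_rpow_eq hα hs hs1
  have hmass : ∑ x, s x * margX P x ^ α = c := by
    rw [← mul_one c, ← R.1.2.2, Finset.mul_sum]
    exact Finset.sum_congr rfl fun x _ => by rw [hR x, mul_div_cancel₀ _ hc.ne']
  have hblind : powNorm α (margU P W) = c ^ (1 / α) := by
    simp only [powNorm, margU_eq_sum_mul_margX, hW _ (margX_nonneg P), hmass]
  have hwithY : ∑ y, (powNorm α fun i => jointUY P W i y) =
      gallagerSum α (condYX P) fun x => s x * margX P x ^ α := by
    simp only [powNorm, jointUY, hW _ fun x => P.2.1 (x, _), gallagerSum, gallagerTerm, mul_assoc,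
      ← Real.mul_rpow (margX_nonneg P _) (condYX_nonneg P _ _), margX_mul_condYX]
  refine ⟨k, W, ?_⟩
  rw [logGain_eq_log_powNorm P W hα, hblind, hwithY, funext hR, gallagerSum_div (condYX_nonneg P)
    (fun x => mul_nonneg (hs x).le (Real.rpow_nonneg (margX_nonneg P x) α)) hc.le]

theorem maxAlphaLeakage_eq (hα : 1 < α) :
    maxAlphaLeakage P α = ((α / (α - 1) * Real.log (maxGallagerSum P α) : ℝ) : EReal) := by
  have hcoef : 0 ≤ α / (α - 1) := div_nonneg (by linarith) (sub_nonneg.2 hα.le)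
  have hmono : MonotoneOn (fun t => α / (α - 1) * Real.log t) (Set.Ioi 0) := fun a ha b _ hab =>
    mul_le_mul_of_nonneg_left (Real.log_le_log ha hab) hcoef
  have hcont : ContinuousOn (fun t => α / (α - 1) * Real.log t) (Set.Ioi 0) :=
    continuousOn_const.mul (Real.continuousOn_log.mono fun _ ht => (Set.mem_Ioi.1 ht).ne')
  rw [← iSup_coe_comp_gallagerSum P hα.le hmono hcont]
  refine le_antisymm ?_ (iSup_le fun R => ?_)
  · rw [maxAlphaLeakage_eq_iSup_logGain P hα]
    refine iSup₂_le fun n W => ?_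
    obtain ⟨R, hR⟩ := exists_logGain_le P W hα
    exact le_iSup_of_le R (EReal.coe_le_coe_iff.2 hR)
  · obtain ⟨k, W, hW⟩ := exists_logGain_eq P hα R
    exact hW ▸ logGain_le_maxAlphaLeakage P W hα

end Leakage

end AlphaLeakage

end

theorem lemma1 {X Y : Type*} [Fintype X] [Fintype Y]
    (P : AlphaLeakage.Dist (X × Y)) (α : ℝ) (hα : 1 < α) :
    -- the limits in the definition of maximal `α`-leakage exist
    (∀ (n : ℕ) (W : AlphaLeakage.Channel X (Fin n)),
      ∃ l : ℝ, Tendsto (AlphaLeakage.logGain P W) (𝓝[≠] α) (𝓝 l)) ∧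
    -- the `f_α`-leakage is a nonnegative real number
    0 ≤ AlphaLeakage.maxFLeakage (AlphaLeakage.hellinger α) P ∧
    AlphaLeakage.maxFLeakage (AlphaLeakage.hellinger α) P < ⊤ ∧
    -- the identity
    AlphaLeakage.maxAlphaLeakage P α =
      ((1 / (α - 1) * Real.log
        (1 + (α - 1) * (AlphaLeakage.maxFLeakage (AlphaLeakage.hellinger α) P).toReal) : ℝ) :
          EReal) := by
  have hC := AlphaLeakage.one_le_maxGallagerSum P hα.le
  have hα1 : 0 < α - 1 := sub_pos.2 hα
  rw [AlphaLeakage.maxFLeakage_hellinger_eq P hα, AlphaLeakage.maxAlphaLeakage_eq P hα]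
  refine ⟨fun n W => ⟨_, AlphaLeakage.tendsto_logGain P W hα⟩, ?_, EReal.coe_lt_top _, ?_⟩
  · exact EReal.coe_nonneg.2
      (div_nonneg (sub_nonneg.2 (Real.one_le_rpow hC (by linarith))) hα1.le)
  · rw [EReal.toReal_coe, mul_div_cancel₀ _ hα1.ne', add_sub_cancel,
      Real.log_rpow (zero_lt_one.trans_le hC), ← mul_assoc, one_div_mul_eq_div]
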